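/- For a finite simple graph $H$ on $N$ vertices let $\mathcal S(H)$ be the set of all real symmetric $N\times N$ matrices, indexed by the vertices of $H$, whose off-diagonal entries are nonzero precisely when the corresponding vertices are adjacent in $H$ (the diagonal entries are arbitrary). Let $q(H)$ be the minimum number of distinct eigenvalues of a matrix in $\mathcal S(H)$. Let $MB(H)$ be the least integer $k$ with $1\le k\le\lfloor N/2\rfloor$ for which some matrix in $\mathcal S(H)$ has exactly two distinct eigenvalues, of multiplicities $N-k$ and $k$ ($MB(H)$ is defined only if such a $k$ exists). The join $G\vee H$ is obtained from the disjoint union of $G$ and $H$ by adding all edges between the vertices of $G$ and the vertices of $H$, and $\overline{K}_m$ is the graph with $m$ vertices and no edges. Lemma. Let $G$ be a connected simple graph on $n\ge 2$ vertices. Then $q(G\vee\overline{K}_{n-1})=2$, and $MB(G\vee\overline{K}_{n-1})$ is defined and equal to $n-1$. -/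

import Mathlib

/-- The join `G ∨ H`: the disjoint union of `G` and `H`, together with all edges between a vertex
of `G` and a vertex of `H`. -/
def graphJoin {V W : Type*} (G : SimpleGraph V) (H : SimpleGraph W) : SimpleGraph (V ⊕ W) :=
  SimpleGraph.sum G H ⊔ completeBipartiteGraph V W

/-- The set `𝒮(G)` of real symmetric matrices whose off-diagonal entries are nonzero precisely
when the corresponding vertices are adjacent; the diagonal is free. -/
def symmMatrices {V : Type*} (G : SimpleGraph V) : Set (Matrix V V ℝ) :=
  {A | A.IsSymm ∧ ∀ i j, i ≠ j → (A i j ≠ 0 ↔ G.Adj i j)}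

/-- `q(A)`: the number of distinct (real) eigenvalues of `A`. -/
noncomputable def numDistinctEigenvalues {V : Type*} [Fintype V] [DecidableEq V]
    (A : Matrix V V ℝ) : ℕ :=
  (spectrum ℝ A).ncard

/-- `q(G) = min {q(A) : A ∈ 𝒮(G)}`. The set `𝒮(G)` is never empty, so the infimum over `ℕ`
is a minimum. -/
noncomputable def minDistinctEigenvalues {V : Type*} [Fintype V] [DecidableEq V]
    (G : SimpleGraph V) : ℕ :=
  sInf (numDistinctEigenvalues '' symmMatrices G)

/-- `G ∈ MP([n₁, …, n_ℓ])`: the list `[n₁, …, n_ℓ]` is a weakly decreasing list of positive integers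
and some `A ∈ 𝒮(G)` has spectrum `{μ₁^(n₁), …, μ_ℓ^(n_ℓ)}` with `μ₁, …, μ_ℓ` distinct. (The
condition on the characteristic polynomial forces `n₁ + ⋯ + n_ℓ` to be the number of vertices.) -/
def IsAchievable {V : Type*} [Fintype V] [DecidableEq V] (G : SimpleGraph V) (l : List ℕ) : Prop :=
  (∀ m ∈ l, 0 < m) ∧ l.Pairwise (· ≥ ·) ∧
    ∃ A ∈ symmMatrices G, ∃ μ : Fin l.length → ℝ, Function.Injective μ ∧
      A.charpoly = ∏ i, (Polynomial.X - Polynomial.C (μ i)) ^ l.get i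

/-- The minimal multiplicity bipartition `MB(G)`: the least `k ≤ ⌊n / 2⌋` such that `G` achieves
`[n - k, k]`, where `n` is the number of vertices of `G`. Only such `k ≥ 1` occur, so
the value is `0` exactly when `MB(G)` is undefined, that is, when no such `k` exists. -/
noncomputable def minMultBipartition {V : Type*} [Fintype V] [DecidableEq V]
    (G : SimpleGraph V) : ℕ :=
  sInf {k : ℕ | k ≤ Fintype.card V / 2 ∧ IsAchievable G [Fintype.card V - k, k]}

/-! A connected `G` has a matrix `A ∈ 𝒮(G)` whose eigenvectors have no zero coordinate, so its
eigenvalues are simple (`exists_nowhereZeroEigenvectors`). Shift and scale `A` so that its spectrum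
lies in `[0, 1)` with least eigenvalue `0`, and write it as `X D Xᵀ` using the `n - 1` other
eigenvectors. Stacking `X √D` on `√(1 - D)` gives orthonormal columns, so `M Mᵀ` is a projection of
rank `n - 1`. Its `G` block agrees with `εA` off the diagonal, its mixed block is nowhere zero and
its last block is diagonal.

Conversely, a two-eigenvalue matrix minus one of its eigenvalues is semidefinite up to sign. On the
`n - 1` independent vertices it is diagonal with nonzero entries, so its rank is at least `n - 1`
(`card_le_of_charpoly`). -/

open Matrix Polynomial

/-- Every eigenvector of `A` has no zero coordinate. -/
def NowhereZeroEigenvectors {V : Type*} [Fintype V] (A : Matrix V V ℝ) : Prop :=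
  ∀ (μ : ℝ) (x : V → ℝ), A *ᵥ x = μ • x → x ≠ 0 → ∀ i, x i ≠ 0

/-! ### Eigenvectors without zero coordinates, and bordering. -/

section Spectral

variable {V : Type*} [Fintype V] [DecidableEq V] {A : Matrix V V ℝ}

omit [Fintype V] [DecidableEq V] in
lemma Matrix.IsSymm.isHermitian_real (hA : A.IsSymm) : A.IsHermitian := by
  rwa [Matrix.IsHermitian, conjTranspose_eq_transpose_of_trivial]

lemma Matrix.IsSymm.exists_orthonormal_eigenbasis (hA : A.IsSymm) :
    ∃ (d : V → ℝ) (x : V → V → ℝ), (∀ k, A *ᵥ x k = d k • x k) ∧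
      (∀ k l, x k ⬝ᵥ x l = if k = l then 1 else 0) ∧
      (∀ i j, ∑ k, x k i * x k j = if i = j then 1 else 0) := by
  have h := hA.isHermitian_real
  refine ⟨h.eigenvalues, fun k => ⇑(h.eigenvectorBasis k), h.mulVec_eigenvectorBasis, ?_, ?_⟩
  · intro k l
    have h1 := congrFun (congrFun (Matrix.mem_unitaryGroup_iff'.1 h.eigenvectorUnitary.2) k) l
    simpa [Matrix.mul_apply, Matrix.star_apply, Matrix.one_apply, dotProduct,
      h.eigenvectorUnitary_apply] using h1
  · intro i j
    have h1 := congrFun (congrFun (Matrix.mem_unitaryGroup_iff.1 h.eigenvectorUnitary.2) i) j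
    simpa [Matrix.mul_apply, Matrix.star_apply, Matrix.one_apply, dotProduct,
      h.eigenvectorUnitary_apply] using h1

lemma sum_dotProduct_mul_eq {x : V → V → ℝ}
    (hx : ∀ i j, ∑ k, x k i * x k j = if i = j then 1 else 0) (y : V → ℝ) (i : V) :
    ∑ k, (x k ⬝ᵥ y) * x k i = y i := by
  simp_rw [dotProduct, Finset.sum_mul]
  rw [Finset.sum_comm]
  have : ∀ j, ∑ k, x k j * y j * x k i = y j * if j = i then 1 else 0 := by
    intro j
    rw [← hx, Finset.mul_sum]
    exact Finset.sum_congr rfl fun k _ => by ring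
  simp [this]

lemma apply_eq_sum_eigenbasis {d : V → ℝ} {x : V → V → ℝ} (hd : ∀ k, A *ᵥ x k = d k • x k)
    (hx : ∀ i j, ∑ k, x k i * x k j = if i = j then 1 else 0) (i j : V) :
    A i j = ∑ k, d k * (x k i * x k j) := by
  have h1 : ∀ k, d k * (x k i * x k j) = ∑ m, A i m * (x k m * x k j) := by
    intro k
    have := congrFun (hd k) i
    simp only [mulVec, dotProduct, Pi.smul_apply, smul_eq_mul] at this
    rw [← mul_assoc, ← this, Finset.sum_mul]
    exact Finset.sum_congr rfl fun k _ => by ring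
  simp_rw [h1]
  rw [Finset.sum_comm]
  simp [← Finset.mul_sum, hx]

omit [DecidableEq V] in
lemma Matrix.IsSymm.dotProduct_mulVec_comm (hA : A.IsSymm) (x y : V → ℝ) :
    x ⬝ᵥ (A *ᵥ y) = (A *ᵥ x) ⬝ᵥ y := by
  rw [dotProduct_mulVec, ← mulVec_transpose, hA.eq]

omit [DecidableEq V] in
lemma Matrix.IsSymm.sub_mul_dotProduct (hA : A.IsSymm) {l : ℝ} {x : V → ℝ}
    (hx : A *ᵥ x = l • x) (μ : ℝ) (y : V → ℝ) :
    (μ - l) * (x ⬝ᵥ y) = x ⬝ᵥ (μ • y - A *ᵥ y) := by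
  rw [dotProduct_sub, hA.dotProduct_mulVec_comm, hx]
  simp [sub_mul]

/-- Two independent eigenvectors for one eigenvalue would combine to one vanishing at a chosen
coordinate. -/
lemma NowhereZeroEigenvectors.injective (h : NowhereZeroEigenvectors A) {d : V → ℝ}
    {x : V → V → ℝ} (hd : ∀ k, A *ᵥ x k = d k • x k)
    (hx : ∀ k l, x k ⬝ᵥ x l = if k = l then 1 else 0) : Function.Injective d := by
  intro k l hkl
  by_contra hne
  have hk0 : x k ≠ 0 := fun h0 => by simpa [h0] using hx k k
  have hl0 : x l ≠ 0 := fun h0 => by simpa [h0] using hx l l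
  have hk := h _ _ (hd k) hk0 k
  have hz : A *ᵥ (x l k • x k - x k k • x l) = d k • (x l k • x k - x k k • x l) := by
    rw [mulVec_sub, mulVec_smul, mulVec_smul, hd, hd, ← hkl, smul_sub, smul_comm,
      smul_comm (x k k)]
  by_cases h0 : x l k • x k - x k k • x l = 0
  · have := congrArg (x l ⬝ᵥ ·) h0
    simp [dotProduct_sub, hx, Ne.symm hne] at this
    exact hk this
  · exact h _ _ hz h0 k (by simp [mul_comm])

/-- With powers of `s` as entries of `b` on `N`, each `b ⬝ᵥ x k` is a nonzero polynomial in `s`; a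
generic `s` avoids all the roots. -/
lemma exists_supported_dotProduct_ne_zero (h : NowhereZeroEigenvectors A) (hA : A.IsSymm)
    {N : Set V} (hN : N.Nonempty) :
    ∃ b : V → ℝ, (∀ i, b i ≠ 0 ↔ i ∈ N) ∧
      ∀ (μ : ℝ) (x : V → ℝ), A *ᵥ x = μ • x → x ≠ 0 → b ⬝ᵥ x ≠ 0 := by
  classical
  obtain ⟨d, x, hd, hx, hx'⟩ := hA.exists_orthonormal_eigenbasis
  have hinj := h.injective hd hx
  let e := Fintype.equivFin V
  let p : V → ℝ[X] := fun k => ∑ j, if j ∈ N then C (x k j) * X ^ (e j : ℕ) else 0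
  have hp : ∀ k, p k ≠ 0 := by
    intro k hk
    obtain ⟨j, hj⟩ := hN
    have hc := congrArg (fun q => q.coeff (e j : ℕ)) hk
    simp only [p, finsetSum_coeff, coeff_zero] at hc
    rw [Finset.sum_eq_single j] at hc
    · simp only [hj, if_true, coeff_C_mul, coeff_X_pow_self, mul_one] at hc
      exact h _ _ (hd k) (fun h0 => by simpa [h0] using hx k k) j hc
    · intro l _ hl
      split_ifs
      · have : (e j : ℕ) ≠ e l := fun h => hl (e.injective (Fin.ext h)).symm
        simp [coeff_X_pow, this]
      · simp
    · simp
  obtain ⟨s, hs⟩ := Infinite.exists_notMem_finset ((X * ∏ k, p k : ℝ[X]).roots.toFinset)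
  have hne : (X * ∏ k, p k : ℝ[X]) ≠ 0 :=
    mul_ne_zero X_ne_zero (Finset.prod_ne_zero_iff.2 fun k _ => hp k)
  simp only [Multiset.mem_toFinset, mem_roots hne, IsRoot, eval_mul, eval_X, eval_prod,
    mul_eq_zero, Finset.prod_eq_zero_iff, not_or, Finset.mem_univ, true_and, not_exists] at hs
  have key : ∀ k, (fun j => if j ∈ N then s ^ (e j : ℕ) else 0) ⬝ᵥ x k ≠ 0 := by
    intro k
    convert hs.2 k using 1
    simp only [p, eval_finsetSum, dotProduct]
    refine Finset.sum_congr rfl fun j _ => ?_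
    split_ifs
    · rw [eval_mul, eval_C, eval_pow, eval_X, mul_comm]
    · rw [eval_zero, zero_mul]
  refine ⟨fun j => if j ∈ N then s ^ (e j : ℕ) else 0, fun i => by simp [hs.1], ?_⟩
  intro μ y hy hy0
  have hsum := sum_dotProduct_mul_eq hx' y
  have hz : ∀ k, (μ - d k) * (x k ⬝ᵥ y) = 0 := fun k => by
    rw [hA.sub_mul_dotProduct (hd k), hy, sub_self, dotProduct_zero]
  obtain ⟨k, hk⟩ : ∃ k, x k ⬝ᵥ y ≠ 0 := by
    by_contra! hc
    exact hy0 (funext fun i => by simp [← hsum i, hc])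
  have hμ : μ = d k := by simpa [hk, sub_eq_zero] using hz k
  have hyk : y = (x k ⬝ᵥ y) • x k := by
    funext i
    rw [← hsum i, Finset.sum_eq_single k]
    · simp
    · intro l _ hl
      have : μ - d l ≠ 0 := by
        rw [hμ, sub_ne_zero]; exact fun h => hl (hinj h).symm
      simp [(mul_eq_zero.1 (hz l)).resolve_left this]
    · simp
  rw [hyk, dotProduct_smul]
  exact smul_ne_zero hk (key k)

/-- Expanding `y` in the eigenbasis, `y i * ∏ (μ - d l)` is a polynomial `q` in `μ`, nonzero because
its value at an eigenvalue is a product of nonzero factors. -/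
lemma finite_resolvent_zeros (h : NowhereZeroEigenvectors A) (hA : A.IsSymm) {b : V → ℝ}
    (hb : ∀ (μ : ℝ) (x : V → ℝ), A *ᵥ x = μ • x → x ≠ 0 → b ⬝ᵥ x ≠ 0) (i : V) :
    {μ : ℝ | ∃ y : V → ℝ, μ • y - A *ᵥ y = b ∧ y i = 0}.Finite := by
  obtain ⟨d, x, hd, hx, hx'⟩ := hA.exists_orthonormal_eigenbasis
  have hinj := h.injective hd hx
  have hx0 : ∀ k, x k ≠ 0 := fun k h0 => by simpa [h0] using hx k k
  let q : ℝ[X] := ∑ k, C ((x k ⬝ᵥ b) * x k i) * ∏ l ∈ Finset.univ.erase k, (X - C (d l))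
  have hq : q ≠ 0 := by
    intro h0
    have hc := congrArg (eval (d i)) h0
    simp only [q, eval_finsetSum, eval_mul, eval_C, eval_prod, eval_sub, eval_X, eval_zero] at hc
    rw [Finset.sum_eq_single i] at hc
    · refine mul_ne_zero (mul_ne_zero ?_ ?_) ?_ hc
      · rw [dotProduct_comm]; exact hb _ _ (hd i) (hx0 i)
      · exact h _ _ (hd i) (hx0 i) i
      · refine Finset.prod_ne_zero_iff.2 fun l hl => sub_ne_zero.2 fun h => ?_
        exact (Finset.ne_of_mem_erase hl) (hinj h).symm
    · intro k _ hk
      rw [Finset.prod_eq_zero (i := i), mul_zero]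
      · simpa using hk.symm
      · simp
    · simp
  refine (q.roots.toFinset.finite_toSet).subset ?_
  rintro μ ⟨y, hy, hyi⟩
  simp only [Finset.mem_coe, Multiset.mem_toFinset, mem_roots hq, IsRoot]
  simp only [q, eval_finsetSum, eval_mul, eval_C, eval_prod, eval_sub, eval_X]
  have : ∀ k, (x k ⬝ᵥ b) * x k i * ∏ l ∈ Finset.univ.erase k, (μ - d l) =
      (∏ l, (μ - d l)) * ((x k ⬝ᵥ y) * x k i) := by
    intro k
    rw [← hy, ← hA.sub_mul_dotProduct (hd k),
      ← Finset.mul_prod_erase Finset.univ _ (Finset.mem_univ k)]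
    ring
  rw [Finset.sum_congr rfl fun k _ => this k, ← Finset.mul_sum, sum_dotProduct_mul_eq hx', hyi,
    mul_zero]

/-- The symmetric matrix obtained from `A` by adding one row and column `b` with corner `c`. -/
def borderedMatrix {W : Type*} (A : Matrix W W ℝ) (b : W → ℝ) (c : ℝ) :
    Matrix (Option W) (Option W) ℝ
  | some i, some j => A i j
  | some i, none => b i
  | none, some j => b j
  | none, none => c

/-- An eigenvector with new coordinate `0` contradicts `hb`. Otherwise, normalised to new coordinate
`1`, its old part `y` solves `(μ - A) y = b` and `c = μ - b ⬝ᵥ y`; a zero in `y` restricts `μ`,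
hence `c`, to a finite set. -/
lemma exists_nowhereZeroEigenvectors_borderedMatrix (h : NowhereZeroEigenvectors A)
    (hA : A.IsSymm) {b : V → ℝ}
    (hb : ∀ (μ : ℝ) (x : V → ℝ), A *ᵥ x = μ • x → x ≠ 0 → b ⬝ᵥ x ≠ 0) :
    ∃ c, NowhereZeroEigenvectors (borderedMatrix A b c) := by
  let Z : Set ℝ := ⋃ i, {μ : ℝ | ∃ y : V → ℝ, μ • y - A *ᵥ y = b ∧ y i = 0}
  have hZ : Z.Finite := Set.finite_iUnion fun i => finite_resolvent_zeros h hA hb i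
  let B : Set ℝ := ⋃ μ ∈ Z, {c : ℝ | ∃ y : V → ℝ, μ • y - A *ᵥ y = b ∧ c = μ - b ⬝ᵥ y}
  have hB : B.Finite := by
    refine hZ.biUnion fun μ _ => Set.Subsingleton.finite ?_
    -- Symmetry of `A` makes `b ⬝ᵥ y` independent of the chosen solution.
    rintro _ ⟨y, hy, rfl⟩ _ ⟨z, hz, rfl⟩
    have : b ⬝ᵥ y = b ⬝ᵥ z := by
      conv_lhs => rw [← hz]
      conv_rhs => rw [← hy]
      rw [sub_dotProduct, sub_dotProduct, ← hA.dotProduct_mulVec_comm, smul_dotProduct,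
        smul_dotProduct, dotProduct_comm z y, dotProduct_comm (A *ᵥ y) z]
    rw [this]
  obtain ⟨c, hc⟩ := hB.exists_notMem
  refine ⟨c, fun μ w hw hw0 => ?_⟩
  set y : V → ℝ := fun i => w (some i) with hy
  set t := w none with ht
  have h1 : A *ᵥ y + t • b = μ • y := by
    funext i
    have := congrFun hw (some i)
    simp only [mulVec, dotProduct, Fintype.sum_option, borderedMatrix, Pi.smul_apply,
      smul_eq_mul] at this
    simp only [mulVec, dotProduct, Pi.add_apply, Pi.smul_apply, smul_eq_mul, hy, ← this]
    ring
  have h2 : b ⬝ᵥ y + c * t = μ * t := by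
    have := congrFun hw none
    simp only [mulVec, dotProduct, Fintype.sum_option, borderedMatrix, Pi.smul_apply,
      smul_eq_mul] at this
    simp only [dotProduct, hy, ht, ← this]
    ring
  have ht0 : t ≠ 0 := by
    intro h0
    rw [h0] at h1 h2
    refine hb μ y (by simpa using h1) (fun hy0 => hw0 ?_) (by simpa using h2)
    funext o
    cases o with
    | none => exact h0
    | some i => exact congrFun hy0 i
  have h3 : μ • (t⁻¹ • y) - A *ᵥ (t⁻¹ • y) = b := by
    rw [mulVec_smul, smul_comm, ← smul_sub, ← h1, add_sub_cancel_left, smul_smul,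
      inv_mul_cancel₀ ht0, one_smul]
  have h4 : c = μ - b ⬝ᵥ (t⁻¹ • y) := by
    rw [dotProduct_smul, smul_eq_mul]
    field_simp
    linarith
  intro o
  cases o with
  | none => exact ht0
  | some i =>
    intro hi
    apply hc
    refine Set.mem_biUnion (x := μ) (Set.mem_iUnion.2 ⟨i, t⁻¹ • y, h3, ?_⟩) ⟨_, h3, h4⟩
    simp [hy, hi]

omit [DecidableEq V] in
lemma NowhereZeroEigenvectors.submatrix {W : Type*} [Fintype W] (h : NowhereZeroEigenvectors A)
    (e : W ≃ V) : NowhereZeroEigenvectors (A.submatrix e e) := by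
  intro μ x hx hx0 i
  have h1 : A *ᵥ (x ∘ e.symm) = μ • (x ∘ e.symm) := by
    rw [submatrix_mulVec_equiv] at hx
    funext j
    simpa using congrFun hx (e.symm j)
  have := h μ _ h1 (fun h0 => hx0 (funext fun j => by simpa using congrFun h0 (e j))) (e i)
  simpa using this

end Spectral

/-- Induction: delete a non-cut vertex, then border with a vector supported on its neighbours. -/
theorem SimpleGraph.Connected.exists_nowhereZeroEigenvectors {V : Type*} [Fintype V]
    {G : SimpleGraph V} (hG : G.Connected) :
    ∃ A ∈ symmMatrices G, NowhereZeroEigenvectors A := by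
  classical
  induction hn : Fintype.card V using Nat.strong_induction_on generalizing V with
  | _ n ih =>
  rcases subsingleton_or_nontrivial V with hV | hV
  · refine ⟨0, ⟨isSymm_zero, fun i j hij => (hij (Subsingleton.elim i j)).elim⟩, ?_⟩
    intro μ x _ hx i hi
    exact hx (funext fun j => by rw [Subsingleton.elim j i, hi]; rfl)
  · obtain ⟨v, hv⟩ := hG.exists_connected_induce_compl_singleton_of_finite_nontrivial
    obtain ⟨A, ⟨hA, hAG⟩, hA0⟩ := ih _ (by
      rw [← hn]; exact Fintype.card_subtype_lt (x := v) (by simp)) hv rfl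
    obtain ⟨u, hu⟩ := hG.preconnected.exists_adj_of_nontrivial v
    obtain ⟨b, hbN, hb⟩ := exists_supported_dotProduct_ne_zero hA0 hA
      (N := {w : ({v}ᶜ : Set V) | G.Adj v w}) ⟨⟨u, hu.ne'⟩, hu⟩
    obtain ⟨c, hc⟩ := exists_nowhereZeroEigenvectors_borderedMatrix hA0 hA hb
    let e : Option ({v}ᶜ : Set V) ≃ V := Equiv.optionSubtypeNe v
    refine ⟨_, ⟨?_, ?_⟩, hc.submatrix e.symm⟩
    · refine IsSymm.submatrix ?_ _
      ext i j
      cases i <;> cases j <;> simp [borderedMatrix, hA.apply]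
    · intro i j hij
      obtain ⟨i, rfl⟩ := e.surjective i
      obtain ⟨j, rfl⟩ := e.surjective j
      simp only [submatrix_apply, Equiv.symm_apply_apply]
      have e1 : e none = v := Equiv.optionSubtypeNe_none v
      have e2 : ∀ w, e (some w) = w := Equiv.optionSubtypeNe_some v
      cases i <;> cases j
      · simp at hij
      · simpa [e1, e2, borderedMatrix] using hbN _
      · simpa [e1, e2, borderedMatrix, G.adj_comm] using hbN _
      · rename_i i j
        simpa [e2, borderedMatrix] using hAG i j (fun h => hij (by rw [h]))


/-! ### Lower bounds from the spectrum. -/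

section Spectrum

variable {V : Type*} [Fintype V] [DecidableEq V] {A : Matrix V V ℝ}

lemma isRoot_charpoly_of_mulVec_eq_smul {μ : ℝ} {x : V → ℝ} (hx : A *ᵥ x = μ • x)
    (hx0 : x ≠ 0) : A.charpoly.IsRoot μ := by
  rw [IsRoot, eval_charpoly]
  refine Matrix.exists_mulVec_eq_zero_iff.1 ⟨x, hx0, ?_⟩
  rw [sub_mulVec, hx, scalar_apply, ← smul_one_eq_diagonal, smul_mulVec, one_mulVec, sub_self]

lemma Matrix.IsSymm.one_lt_numDistinctEigenvalues (hA : A.IsSymm) {i j : V} (hij : i ≠ j)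
    (h : A i j ≠ 0) : 1 < numDistinctEigenvalues A := by
  obtain ⟨d, x, hd, hx, hx'⟩ := hA.exists_orthonormal_eigenbasis
  have hmem : ∀ k, d k ∈ spectrum ℝ A := fun k =>
    mem_spectrum_iff_isRoot_charpoly.2
      (isRoot_charpoly_of_mulVec_eq_smul (hd k) fun h0 => by simpa [h0] using hx k k)
  by_contra! hle
  have hsub := (Set.ncard_le_one Matrix.finite_real_spectrum).1 hle
  apply h
  rw [apply_eq_sum_eigenbasis hd hx',
    Finset.sum_congr rfl fun k _ => by rw [hsub (d k) (hmem k) (d i) (hmem i)],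
    ← Finset.mul_sum, hx', if_neg hij, mul_zero]

lemma Matrix.IsHermitian.rank_le_of_charpoly (hA : A.IsHermitian) {c : ℝ} {m k : ℕ}
    (h : A.charpoly = X ^ m * (X - C c) ^ k) : A.rank ≤ k := by
  have hroots : A.charpoly.roots = Multiset.replicate m 0 + Multiset.replicate k c := by
    rw [h, roots_mul (mul_ne_zero (pow_ne_zero _ X_ne_zero) (pow_ne_zero _ (X_sub_C_ne_zero c))),
      roots_pow, roots_pow, roots_X, roots_X_sub_C, Multiset.nsmul_singleton,
      Multiset.nsmul_singleton]
  rw [hA.rank_eq_card_non_zero_eigs]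
  have h1 := congrArg (fun s => (s.filter (· ≠ 0)).card) (hA.roots_charpoly_eq_eigenvalues)
  simp only [hroots, Multiset.filter_add, Multiset.card_add, Multiset.filter_map,
    Multiset.card_map] at h1
  rw [Fintype.card_subtype]
  refine le_trans (le_of_eq ?_) (h1.symm.le.trans ?_)
  · rfl
  · rw [Multiset.filter_eq_nil.2 (fun a ha => by simp [Multiset.eq_of_mem_replicate ha]),
      Multiset.card_zero, zero_add]
    exact (Multiset.card_le_card (Multiset.filter_le _ _)).trans_eq (Multiset.card_replicate _ _)

lemma Matrix.IsSymm.card_le_of_charpoly (hA : A.IsSymm) {a b : ℝ} {m k : ℕ}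
    (h : A.charpoly = (X - C a) ^ m * (X - C b) ^ k) {ι : Type*} [Fintype ι] (f : ι → V)
    (hf : ∀ i j, i ≠ j → A (f i) (f j) = 0 ∧ f i ≠ f j)
    (hne : ∀ i, ∃ j, f i ≠ j ∧ A (f i) j ≠ 0) : Fintype.card ι ≤ k := by
  classical
  set Q := A - scalar V a with hQ
  have hQs : Q.IsSymm := hA.sub (by simp [IsSymm])
  have hoff : ∀ i j, i ≠ j → Q i j = A i j := fun i j hij => by simp [hQ, hij]
  have hQc : Q.charpoly = X ^ m * (X - C (b - a)) ^ k := by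
    rw [hQ, charpoly_sub_scalar, h]
    simp only [mul_comp, pow_comp, sub_comp, X_comp, C_comp, C_sub]
    ring
  obtain ⟨d, x, hd, hx, hx'⟩ := hQs.exists_orthonormal_eigenbasis
  have hdk : ∀ k, d k = 0 ∨ d k = b - a := fun l => by
    have := isRoot_charpoly_of_mulVec_eq_smul (hd l) fun h0 => by simpa [h0] using hx l l
    rw [hQc, IsRoot, eval_mul, eval_pow, eval_pow, eval_sub, eval_X, eval_C, mul_eq_zero] at this
    exact this.imp eq_zero_of_pow_eq_zero fun h => sub_eq_zero.1 (eq_zero_of_pow_eq_zero h)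
  have hdiag : ∀ i, Q (f i) (f i) ≠ 0 := by
    intro i h0
    obtain ⟨j, hij, hj⟩ := hne i
    rw [← hoff _ _ hij, apply_eq_sum_eigenbasis hd hx'] at hj
    rw [apply_eq_sum_eigenbasis hd hx'] at h0
    apply hj
    refine Finset.sum_eq_zero fun l _ => ?_
    -- As `d l ∈ {0, b - a}`, this is the sum of the squares `(d l * x l (f i))²`; its vanishing
    -- kills the whole row of `Q`.
    have hs : (b - a) * ∑ l, d l * (x l (f i) * x l (f i)) = 0 := by rw [h0, mul_zero]
    rw [Finset.mul_sum, Finset.sum_eq_zero_iff_of_nonneg] at hs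
    · have := hs l (Finset.mem_univ l)
      rcases hdk l with h | h
      · simp [h]
      · rw [← h] at this
        have : d l * x l (f i) = 0 := by
          rw [← mul_self_eq_zero]; linarith
        rw [← mul_assoc, this, zero_mul]
    · intro l _
      rcases hdk l with h | h
      · simp [h]
      · rw [← h]
        nlinarith [mul_self_nonneg (d l * x l (f i))]
  have hsub : Q.submatrix f f = diagonal fun i => Q (f i) (f i) := by
    ext i j
    by_cases hij : i = j
    · simp [hij]
    · simp only [submatrix_apply, diagonal_apply_ne _ hij]
      rw [hoff _ _ (hf i j hij).2, (hf i j hij).1]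
  have hr : (Q.submatrix f f).rank = Fintype.card ι := by
    rw [hsub, rank_diagonal]
    exact Fintype.card_of_subtype Finset.univ (by simp [hdiag])
  rw [← hr]
  exact (rank_submatrix_le Q f f).trans (hQs.isHermitian_real.rank_le_of_charpoly hQc)

end Spectrum

/-! ### The join and its projection matrix. -/

section Join

variable {V W : Type*} (G : SimpleGraph V) (H : SimpleGraph W)

@[simp] lemma graphJoin_adj_inl_inl {u v : V} :
    (graphJoin G H).Adj (.inl u) (.inl v) ↔ G.Adj u v := by
  simp [graphJoin, completeBipartiteGraph]

@[simp] lemma graphJoin_adj_inr_inr {u v : W} :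
    (graphJoin G H).Adj (.inr u) (.inr v) ↔ H.Adj u v := by
  simp [graphJoin, completeBipartiteGraph]

@[simp] lemma graphJoin_adj_inl_inr {u : V} {v : W} :
    (graphJoin G H).Adj (.inl u) (.inr v) := by
  simp [graphJoin, completeBipartiteGraph]

@[simp] lemma graphJoin_adj_inr_inl {u : V} {v : W} :
    (graphJoin G H).Adj (.inr v) (.inl u) := by
  simp [graphJoin, completeBipartiteGraph]

end Join

/-- The join of a connected graph on `n` vertices and `n - 1` isolated vertices is the graph of
an orthogonal projection of rank `n - 1`. -/
theorem SimpleGraph.Connected.exists_projection_mem_symmMatrices_join {V S : Type*} [Fintype V]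
    [DecidableEq V] [Fintype S] [DecidableEq S] {G : SimpleGraph V} (hG : G.Connected)
    (hcard : Fintype.card V = Fintype.card S + 1) :
    ∃ P ∈ symmMatrices (graphJoin G (⊤ : SimpleGraph S)ᶜ),
      P.charpoly = X ^ Fintype.card V * (X - 1) ^ Fintype.card S := by
  obtain ⟨A, ⟨hA, hAG⟩, hA0⟩ := hG.exists_nowhereZeroEigenvectors
  obtain ⟨l, x, hl, hx, hx'⟩ := hA.exists_orthonormal_eigenbasis
  have hinj := hA0.injective hl hx
  have := hG.nonempty
  -- The least eigenvalue is shifted to `0`, so its eigenvector drops out, leaving one column for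
  -- each element of `S`.
  obtain ⟨o, ho⟩ := Finite.exists_min l
  obtain ⟨σ⟩ : Nonempty (S ≃ {k // k ≠ o}) := by
    rw [← Fintype.card_eq, Fintype.card_subtype_compl, Fintype.card_subtype_eq, hcard]; simp
  obtain ⟨ε, hε, hε1⟩ : ∃ ε : ℝ, 0 < ε ∧ ∀ k, ε * (l k - l o) < 1 := by
    obtain ⟨t, ht⟩ := Finite.exists_max l
    have h0 := ho t
    refine ⟨(l t - l o + 1)⁻¹, by positivity, fun k => ?_⟩
    rw [inv_mul_lt_one₀ (by linarith)]
    linarith [ht k]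
  set d : V → ℝ := fun k => ε * (l k - l o) with hd
  have hd0 : ∀ s, 0 < d (σ s) := fun s =>
    mul_pos hε (sub_pos.2 ((ho _).lt_of_ne fun h => (σ s).2 (hinj h).symm))
  have hsum : ∀ g : V → ℝ, g o = 0 → ∑ s, g (σ s) = ∑ k, g k := by
    intro g hg
    rw [Equiv.sum_comp σ (fun k => g k), ← Fintype.sum_subtype_add_sum_subtype (· ≠ o) g,
      left_eq_add]
    exact Finset.sum_eq_zero fun k _ => by rw [not_not.1 k.2, hg]
  let M : Matrix (V ⊕ S) S ℝ := fromRows (of fun i s => x (σ s) i * √(d (σ s)))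
    (diagonal fun s => √(1 - d (σ s)))
  have hin : ∀ i s, M (.inl i) s = x (σ s) i * √(d (σ s)) := fun i s => rfl
  have hir : ∀ r s, M (.inr r) s = if r = s then √(1 - d (σ r)) else 0 := fun r s => rfl
  have hS : (M * Mᵀ).IsSymm := by rw [IsSymm, transpose_mul, transpose_transpose]
  have hMM : Mᵀ * M = 1 := by
    ext s t
    simp only [Matrix.mul_apply, transpose_apply, Fintype.sum_sum_type, hin, hir]
    have h1 : ∑ i, x (σ s) i * √(d (σ s)) * (x (σ t) i * √(d (σ t))) =
        √(d (σ s)) * √(d (σ t)) * (x (σ s) ⬝ᵥ x (σ t)) := by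
      rw [dotProduct, Finset.mul_sum]
      exact Finset.sum_congr rfl fun i _ => by ring
    rw [h1, hx]
    by_cases hst : s = t
    · subst hst
      have := hε1 (σ s)
      simp only [if_true, mul_one, one_apply_eq, mul_ite, ite_mul, zero_mul, mul_zero,
        Finset.sum_ite_eq', Finset.mem_univ]
      rw [Real.mul_self_sqrt (hd0 s).le, Real.mul_self_sqrt (by simp only [hd]; linarith)]
      ring
    · have : (σ s : V) ≠ σ t := fun h => hst (σ.injective (Subtype.ext h))
      simp [hst, Ne.symm hst, this]
  refine ⟨M * Mᵀ, ⟨hS, ?_⟩, ?_⟩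
  · have hne : ∀ i s, (M * Mᵀ) (.inl i) (.inr s) ≠ 0 := by
      intro i s
      simp only [Matrix.mul_apply, transpose_apply, hin, hir, mul_ite, mul_zero,
        Finset.sum_ite_eq, Finset.mem_univ, if_true]
      refine mul_ne_zero (mul_ne_zero ?_ (Real.sqrt_pos.2 (hd0 s)).ne')
        (Real.sqrt_pos.2 (sub_pos.2 (hε1 _))).ne'
      exact hA0 _ _ (hl _) (fun h0 => by simpa [h0] using hx (σ s) (σ s)) i
    rintro (i | i) (j | j) hij
    · have hij' : i ≠ j := fun h => hij (by rw [h])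
      have : (M * Mᵀ) (.inl i) (.inl j) = ε * A i j := by
        have h1 : ∀ s, M (.inl i) s * M (.inl j) s =
            (fun k => d k * (x k i * x k j)) (σ s) := fun s => by
          rw [hin, hin]
          linear_combination x (σ s) i * x (σ s) j * Real.mul_self_sqrt (hd0 s).le
        simp only [Matrix.mul_apply, transpose_apply]
        rw [Finset.sum_congr rfl fun s _ => h1 s, hsum (fun k => d k * (x k i * x k j)) (by simp [hd]),
          apply_eq_sum_eigenbasis hl hx' i j, Finset.mul_sum]
        have h2 := hx' i j
        rw [if_neg hij'] at h2
        rw [← sub_eq_zero, ← Finset.sum_sub_distrib]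
        calc _ = ∑ k, (-(ε * l o)) * (x k i * x k j) :=
              Finset.sum_congr rfl fun k _ => by simp only [hd]; ring
          _ = 0 := by rw [← Finset.mul_sum, h2, mul_zero]
      rw [this, graphJoin_adj_inl_inl, ← hAG i j hij']
      simp [hε.ne']
    · simp [hne i j]
    · rw [hS.apply]
      simp [hne j i]
    · have hij' : i ≠ j := fun h => hij (by rw [h])
      simp [Matrix.mul_apply, hir, hij']
  -- `M Mᵀ` and `Mᵀ M = 1` have the same characteristic polynomial up to a power of `X`.
  · rw [charpoly_mul_comm_of_le _ _ (by simp), hMM, charpoly_one]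
    simp

theorem lemma3p13 {V : Type*} [Fintype V] [DecidableEq V] (G : SimpleGraph V) (n : ℕ)
    (hn : 2 ≤ n) (hcard : Fintype.card V = n) (hG : G.Connected) :
    minDistinctEigenvalues (graphJoin G (⊤ : SimpleGraph (Fin (n - 1)))ᶜ) = 2 ∧
      minMultBipartition (graphJoin G (⊤ : SimpleGraph (Fin (n - 1)))ᶜ) = n - 1 := by
  obtain ⟨P, hP, hPc⟩ := hG.exists_projection_mem_symmMatrices_join (S := Fin (n - 1))
    (by rw [Fintype.card_fin]; omega)
  rw [Fintype.card_fin, hcard] at hPc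
  obtain ⟨v⟩ := hG.nonempty
  have hN : Fintype.card (V ⊕ Fin (n - 1)) = n + (n - 1) := by simp [hcard]
  let s : Fin (n - 1) := ⟨0, by omega⟩
  constructor
  · apply le_antisymm
    · refine Nat.sInf_le ⟨P, hP, ?_⟩
      have : spectrum ℝ P = {0, 1} := by
        ext μ
        rw [mem_spectrum_iff_isRoot_charpoly, hPc]
        have h1 : n ≠ 0 := by omega
        have h2 : n - 1 ≠ 0 := by omega
        simp [IsRoot, h1, h2, sub_eq_zero]
      rw [numDistinctEigenvalues, this, Set.ncard_pair zero_ne_one]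
    · refine le_csInf ⟨_, P, hP, rfl⟩ ?_
      rintro _ ⟨A, hA, rfl⟩
      exact hA.1.one_lt_numDistinctEigenvalues (i := .inl v) (j := .inr s) (by simp)
        ((hA.2 _ _ (by simp)).2 (by simp))
  · have hmem : n - 1 ∈ {k : ℕ | k ≤ Fintype.card (V ⊕ Fin (n - 1)) / 2 ∧
        IsAchievable (graphJoin G (⊤ : SimpleGraph (Fin (n - 1)))ᶜ)
          [Fintype.card (V ⊕ Fin (n - 1)) - k, k]} := by
      rw [Set.mem_ofPred_eq, hN]
      refine ⟨by omega, ?_, ?_, P, hP, ![0, 1], ?_, ?_⟩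
      · simp; omega
      · simp
      · intro i j
        fin_cases i <;> fin_cases j <;> simp
      · rw [hPc]
        simp [Fin.prod_univ_succ]
    apply le_antisymm (Nat.sInf_le hmem)
    refine le_csInf ⟨_, hmem⟩ ?_
    rintro k ⟨-, -, -, A, hA, μ, -, hc⟩
    have hc' : A.charpoly = (X - C (μ 0)) ^ (Fintype.card (V ⊕ Fin (n - 1)) - k) *
        (X - C (μ 1)) ^ k := by
      rw [hc]
      exact Fin.prod_univ_two _
    -- The added vertices are independent, and each is adjacent to `v`.
    have := hA.1.card_le_of_charpoly hc' (ι := Fin (n - 1)) Sum.inr (fun i j hij => ?_)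
      (fun i => ⟨.inl v, by simp, (hA.2 _ _ (by simp)).2 (by simp)⟩)
    · simpa using this
    · have hij' : (Sum.inr i : V ⊕ Fin (n - 1)) ≠ .inr j := fun h => hij (Sum.inr_injective h)
      exact ⟨not_not.1 fun h => by simpa [hij] using (hA.2 _ _ hij').1 h, hij'⟩
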